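/- Let $N\ge 1$, let $\Xi=\Xi_1\times\cdots\times\Xi_N$ be a finite sample space whose elements $\xi=(\xi_1,\dots,\xi_N)$ have probabilities $p(\xi)>0$ with $\sum_{\xi\in\Xi}p(\xi)=1$, and let $n=n_1+\cdots+n_N$. Let $\mathcal L_n$ be the Hilbert space of all mappings $x(\cdot):\Xi\to\mathbb R^n$, $x(\xi)=(x_1(\xi),\dots,x_N(\xi))$ with $x_k(\xi)\in\mathbb R^{n_k}$, with inner product $$\langle x(\cdot),w(\cdot)\rangle=\sum_{\xi\in\Xi}p(\xi)\sum_{k=1}^N\langle x_k(\xi),w_k(\xi)\rangle .$$ Let $\mathcal N_n$ be the subspace of those $x(\cdot)\in\mathcal L_n$ such that, for every $k$, $x_k(\xi)$ does not depend on $\xi_k,\dots,\xi_N$. For each $\xi\in\Xi$ let $C(\xi)\subset\mathbb R^n$ be nonempty, closed and convex, and let $\mathcal C=\{x(\cdot)\in\mathcal L_n: x(\xi)\in C(\xi)\ \forall \xi\in\Xi\}$. Let $F:\mathbb R^n\times\Xi\to\mathbb R^n$ and let $\mathcal F:\mathcal L_n\to\mathcal L_n$ be given by $\mathcal F(x(\cdot))(\xi)=F(x(\xi),\xi)$.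 Write $\mathcal K=\mathcal C\cap\mathcal N_n$, and let $\mathrm{SOL}(\mathcal K,\mathcal F)$ be the solution set of the multistage stochastic variational inequality $-\mathcal F(x(\cdot))\in N_{\mathcal K}(x(\cdot))$, that is, the set of all $x(\cdot)\in\mathcal K$ with $\langle \mathcal F(x(\cdot)),y(\cdot)-x(\cdot)\rangle\ge 0$ for all $y(\cdot)\in\mathcal K$. Let $\mathcal K_\infty=\{d(\cdot)\in\mathcal L_n: x(\cdot)+\tau d(\cdot)\in\mathcal K\ \forall x(\cdot)\in\mathcal K,\ \tau\ge 0\}$ be the recession cone of $\mathcal K$, and for $S\subset\mathcal L_n$ let $S^*=\{d(\cdot)\in\mathcal L_n:\langle v(\cdot),d(\cdot)\rangle\ge 0\ \forall v(\cdot)\in S\}$ be its dual cone. Assume that $\mathcal F$ is continuous and pseudomonotone on $\mathcal K$, i.e. for all $x(\cdot),y(\cdot)\in\mathcal K$, $$\langle y(\cdot)-x(\cdot),\mathcal F(x(\cdot))\rangle\ge 0\ \Longrightarrow\ \langle y(\cdot)-x(\cdot),\mathcal F(y(\cdot))\rangle\ge 0 .$$ Then: (a) $\mathrm{SOL}(\mathcal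 K,\mathcal F)$ is convex. (b) If there exists $\hat x(\cdot)\in\mathcal K$ such that $\mathcal F(\hat x(\cdot))\in\mathrm{int}\big((\mathcal K_\infty)^*\big)$, then $\mathrm{SOL}(\mathcal K,\mathcal F)$ is nonempty, convex and compact. -/

import Mathlib

open scoped RealInnerProductSpace

noncomputable section

namespace MultistageSVI

/-- The probability law of a random vector `ξ = (ξ₁, …, ξ_N)` with finite sample space
`Ξ = Ξ₁ × ⋯ × Ξ_N`: every realization has positive probability, and these add up to `1`. -/
structure ScenarioLaw {N : ℕ} (Ξ : Fin N → Type*) [∀ k, Fintype (Ξ k)] where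
  prob : (∀ k, Ξ k) → ℝ
  prob_pos : ∀ ξ, 0 < prob ξ
  prob_sum : ∑ ξ, prob ξ = 1

/-- The decision space `ℝⁿ = ℝ^{n₁} × ⋯ × ℝ^{n_N}` with its Euclidean structure; the component
`x k` is the decision vector of stage `k`. -/
abbrev Decision {N : ℕ} (n : Fin N → ℕ) : Type :=
  PiLp 2 (fun k => EuclideanSpace ℝ (Fin (n k)))

/-- The space `𝓛ₙ` of all mappings `x(·) : Ξ → ℝⁿ`. The law `P` occurs in the type because the
inner product depends on it. -/
def LSpace {N : ℕ} {Ξ : Fin N → Type*} [∀ k, Fintype (Ξ k)]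
    (_P : ScenarioLaw Ξ) (n : Fin N → ℕ) : Type _ :=
  (∀ k, Ξ k) → Decision n

section Hilbert

variable {N : ℕ} {Ξ : Fin N → Type*} [∀ k, Fintype (Ξ k)] (P : ScenarioLaw Ξ) (n : Fin N → ℕ)

instance : AddCommGroup (LSpace P n) :=
  inferInstanceAs (AddCommGroup ((∀ k, Ξ k) → Decision n))

instance : Module ℝ (LSpace P n) :=
  inferInstanceAs (Module ℝ ((∀ k, Ξ k) → Decision n))

/-- The inner product `⟨x(·), w(·)⟩ = ∑_ξ p(ξ) ∑_k ⟨x_k(ξ), w_k(ξ)⟩`. -/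
@[reducible]
def LSpace.innerCore : InnerProductSpace.Core ℝ (LSpace P n) where
  inner x w := ∑ ξ, P.prob ξ * ∑ k, ⟪x ξ k, w ξ k⟫
  conj_inner_symm x w := by
    simp only [conj_trivial]
    exact Finset.sum_congr rfl fun ξ _ => by
      congr 1
      exact Finset.sum_congr rfl fun k _ => real_inner_comm _ _
  re_inner_nonneg x := by
    simp only [RCLike.re_to_real]
    exact Finset.sum_nonneg fun ξ _ => mul_nonneg (P.prob_pos ξ).le
      (Finset.sum_nonneg fun k _ => real_inner_self_nonneg)
  add_left x y w := by
    rw [← Finset.sum_add_distrib]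
    refine Finset.sum_congr rfl fun ξ _ => ?_
    rw [← mul_add, ← Finset.sum_add_distrib]
    congr 1
    exact Finset.sum_congr rfl fun k _ => inner_add_left (x ξ k) (y ξ k) (w ξ k)
  smul_left x w r := by
    simp only [conj_trivial]
    rw [Finset.mul_sum]
    refine Finset.sum_congr rfl fun ξ _ => ?_
    rw [mul_left_comm r, Finset.mul_sum (a := r)]
    congr 1
    exact Finset.sum_congr rfl fun k _ => real_inner_smul_left (x ξ k) (w ξ k) r
  definite x hx := by
    have hnn : ∀ ξ, 0 ≤ ∑ k, ⟪x ξ k, x ξ k⟫ := fun ξ =>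
      Finset.sum_nonneg fun k _ => real_inner_self_nonneg
    have h1 := (Finset.sum_eq_zero_iff_of_nonneg
      (fun ξ _ => mul_nonneg (P.prob_pos ξ).le (hnn ξ))).1 hx
    refine funext fun ξ => PiLp.ext fun k => ?_
    have h2 := (mul_eq_zero.1 (h1 ξ (Finset.mem_univ ξ))).resolve_left (P.prob_pos ξ).ne'
    exact inner_self_eq_zero.1 ((Finset.sum_eq_zero_iff_of_nonneg
      (fun k _ => real_inner_self_nonneg)).1 h2 k (Finset.mem_univ k))

instance : NormedAddCommGroup (LSpace P n) :=
  (LSpace.innerCore P n).toNormedAddCommGroup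

instance : InnerProductSpace ℝ (LSpace P n) :=
  InnerProductSpace.ofCore (LSpace.innerCore P n).toCore

instance : FiniteDimensional ℝ (LSpace P n) :=
  inferInstanceAs (FiniteDimensional ℝ ((∀ k, Ξ k) → Decision n))

instance : CompleteSpace (LSpace P n) := FiniteDimensional.complete ℝ _

theorem LSpace.inner_def (x w : LSpace P n) :
    ⟪x, w⟫ = ∑ ξ, P.prob ξ * ∑ k, ⟪x ξ k, w ξ k⟫ := rfl

/-- The nonanticipativity subspace `𝓝ₙ`: `x_k(ξ)` does not depend on `ξ_k, …, ξ_N`, i.e. it takes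
the same value at any two scenarios that agree in all coordinates before `k`. -/
def nonanticipative : Submodule ℝ (LSpace P n) where
  carrier := {x | ∀ (k : Fin N) (ξ ξ' : ∀ k, Ξ k), (∀ j < k, ξ j = ξ' j) → x ξ k = x ξ' k}
  zero_mem' := fun _ _ _ _ => rfl
  add_mem' := fun {x y} hx hy k ξ ξ' h =>
    show x ξ k + y ξ k = x ξ' k + y ξ' k by rw [hx k ξ ξ' h, hy k ξ ξ' h]
  smul_mem' := fun c x hx k ξ ξ' h =>
    show c • x ξ k = c • x ξ' k by rw [hx k ξ ξ' h]

variable {n}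

/-- The constraint set `𝓒 = {x(·) : x(ξ) ∈ C(ξ) for all ξ ∈ Ξ}`. -/
def constraintSet (C : (∀ k, Ξ k) → Set (Decision n)) : Set (LSpace P n) :=
  {x | ∀ ξ, x ξ ∈ C ξ}

/-- The feasible set `𝓒 ∩ 𝓝ₙ`. -/
def feasibleSet (C : (∀ k, Ξ k) → Set (Decision n)) : Set (LSpace P n) :=
  constraintSet P C ∩ nonanticipative P n

/-- The mapping `𝓕 : 𝓛ₙ → 𝓛ₙ`, `𝓕(x(·)) : ξ ↦ F(x(ξ), ξ)`. -/
def inducedMap (F : Decision n → (∀ k, Ξ k) → Decision n) : LSpace P n → LSpace P n :=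
  fun x ξ => F (x ξ) ξ

end Hilbert

section VariationalInequality

variable {E : Type*} [NormedAddCommGroup E] [InnerProductSpace ℝ E]

/-- `G` is pseudomonotone on `K`. -/
def PseudomonotoneOn (G : E → E) (K : Set E) : Prop :=
  ∀ x ∈ K, ∀ y ∈ K, 0 ≤ ⟪y - x, G x⟫ → 0 ≤ ⟪y - x, G y⟫

/-- The normal cone of `K` at `x`, which is empty if `x ∉ K`. -/
def normalCone (K : Set E) (x : E) : Set E :=
  {v | x ∈ K ∧ ∀ y ∈ K, ⟪v, y - x⟫ ≤ 0}

/-- The solution set `SOL(K, G)` of the variational inequality `-G(x) ∈ N_K(x)`. -/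
def SOL (K : Set E) (G : E → E) : Set E :=
  {x | -G x ∈ normalCone K x}

/-- The recession cone `K_∞ = {d : x + τ d ∈ K for all x ∈ K and τ ≥ 0}`. -/
def recessionCone (K : Set E) : Set E :=
  {d | ∀ x ∈ K, ∀ τ : ℝ, 0 ≤ τ → x + τ • d ∈ K}

end VariationalInequality

end MultistageSVI

end

open MultistageSVI

/-! By Minty's lemma, pseudomonotonicity and continuity make the solution set the intersection of
`K` with the closed half-spaces `mintyHalfSpace G y`, `y ∈ K`; hence it is closed and convex. For
existence, a KKM principle gives finitely many of these half-spaces a common point in `K`. The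
interior condition at `a` makes `K ∩ mintyHalfSpace G a` compact, since an unbounded part would
produce a recession direction `d ≠ 0` with `⟪d, G a⟫ ≤ 0`. Compactness passes from finite
intersections to the whole family. -/

namespace MultistageSVI

open scoped RealInnerProductSpace
open Filter Topology

/-! ### Intersection theorems for closed convex sets -/

section ConvexCover

variable {E ι : Type*} [NormedAddCommGroup E] [InnerProductSpace ℝ E]

/-- A Klee–Berge intersection theorem: if closed convex sets cover a compact convex set `U`, and any
all-but-one of them have a common point in `U`, then all of them have a common point in `U`. -/
theorem exists_mem_forall_of_convex_cover [DecidableEq ι] {s : Finset ι} (hs : s.Nonempty)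
    {C : ι → Set E} (hCc : ∀ i, IsClosed (C i)) (hCv : ∀ i, Convex ℝ (C i)) {U : Set E}
    (hU : IsCompact U) (hUv : Convex ℝ U) (hcover : ∀ x ∈ U, ∃ i ∈ s, x ∈ C i)
    (hcommon : ∀ j ∈ s, ∃ x ∈ U, ∀ i ∈ s, i ≠ j → x ∈ C i) :
    ∃ x ∈ U, ∀ i ∈ s, x ∈ C i := by
  induction hs using Finset.Nonempty.cons_induction generalizing U with
  | singleton a =>
    obtain ⟨x, hx, -⟩ := hcommon a (by simp)
    obtain ⟨i, hi, hxi⟩ := hcover x hx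
    refine ⟨x, hx, fun j hj => ?_⟩
    rw [Finset.mem_singleton] at hi hj
    rwa [hj, ← hi]
  | cons a s has hs ih =>
    by_contra! hne
    have hD : IsClosed (⋂ i ∈ s, C i) := isClosed_biInter fun i _ => hCc i
    have hDv : Convex ℝ (⋂ i ∈ s, C i) := convex_iInter₂ fun i _ => hCv i
    have hdisj : Disjoint (U ∩ C a) (U ∩ ⋂ i ∈ s, C i) := by
      refine Set.disjoint_left.2 fun x hxa hxD => ?_
      obtain ⟨i, hi, hxi⟩ := hne x hxa.1
      rcases Finset.mem_cons.1 hi with rfl | hi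
      · exact hxi hxa.2
      · exact hxi (Set.mem_iInter₂.1 hxD.2 i hi)
    obtain ⟨f, u, v, hfu, huv, hfv⟩ := geometric_hahn_banach_compact_closed
      (hUv.inter (hCv a)) (hU.inter_right (hCc a)) (hUv.inter hDv)
      (hU.inter_right hD).isClosed hdisj
    obtain ⟨q, hqU, hq⟩ := hcommon a (Finset.mem_cons_self a s)
    have hqs : ∀ i ∈ s, q ∈ C i := fun i hi =>
      hq i (Finset.mem_cons_of_mem hi) fun h => has (h ▸ hi)
    have hfq : v < f q := hfv q ⟨hqU, Set.mem_iInter₂.2 hqs⟩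
    -- Induct on the slice `f = u`. It misses `C a` and the intersection of the other sets, so those
    -- others cover it, yet a common point of theirs in it is impossible.
    obtain ⟨x, ⟨hxU, hxu⟩, hx⟩ := ih (U := U ∩ {x | f x = u})
      (hU.inter_right (isClosed_eq f.continuous continuous_const))
      (hUv.inter (convex_hyperplane f.isLinear u))
      (fun x ⟨hxU, hxu⟩ => by
        obtain ⟨i, hi, hxi⟩ := hcover x hxU
        rcases Finset.mem_cons.1 hi with rfl | hi
        · exact absurd hxu (hfu x ⟨hxU, hxi⟩).ne
        · exact ⟨i, hi, hxi⟩)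
      (fun j hj => by
        obtain ⟨p, hpU, hp⟩ := hcommon j (Finset.mem_cons_of_mem hj)
        have hfp : f p < u := hfu p
          ⟨hpU, hp a (Finset.mem_cons_self a s) fun h => has (h ▸ hj)⟩
        -- The segment from `p` (where `f < u`) to `q` (where `f > u`) must cross the slice, and it
        -- stays in each `C i` containing both ends.
        have hpre : IsPreconnected (segment ℝ p q) := (convex_segment p q).isPreconnected
        obtain ⟨z, hz, hzu⟩ := hpre.intermediate_value (left_mem_segment ℝ p q)
          (right_mem_segment ℝ p q) f.continuous.continuousOn ⟨hfp.le, (huv.trans hfq).le⟩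
        exact ⟨z, ⟨hUv.segment_subset hpU hqU hz, hzu⟩, fun i hi hij =>
          (hCv i).segment_subset (hp i (Finset.mem_cons_of_mem hi) hij) (hqs i hi) hz⟩)
    exact (huv.trans (hfv x ⟨hxU, Set.mem_iInter₂.2 hx⟩)).ne' hxu

/-- The Knaster–Kuratowski–Mazurkiewicz principle for families of closed convex sets. -/
theorem exists_mem_convexHull_forall_of_KKM {C : E → Set E} (hCc : ∀ y, IsClosed (C y))
    (hCv : ∀ y, Convex ℝ (C y)) {s : Finset E} (hs : s.Nonempty)
    (hKKM : ∀ t ⊆ s, ∀ x ∈ convexHull ℝ (t : Set E), ∃ y ∈ t, x ∈ C y) :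
    ∃ x ∈ convexHull ℝ (s : Set E), ∀ y ∈ s, x ∈ C y := by
  classical
  induction s using Finset.strongInduction with
  | H s ih =>
    refine exists_mem_forall_of_convex_cover hs hCc hCv (s.finite_toSet.isCompact_convexHull (𝕜 := ℝ))
      (convex_convexHull ℝ _) (hKKM s subset_rfl) fun j hj => ?_
    rcases (s.erase j).eq_empty_or_nonempty with he | hne
    · refine ⟨j, subset_convexHull ℝ _ hj, fun i hi hij => ?_⟩
      simpa [he] using Finset.mem_erase.2 ⟨hij, hi⟩
    · obtain ⟨x, hx, hxC⟩ := ih _ (Finset.erase_ssubset hj) hne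
        fun t ht => hKKM t (ht.trans (Finset.erase_subset j s))
      exact ⟨x, convexHull_mono (Finset.coe_subset.2 (Finset.erase_subset j s)) hx,
        fun i hi hij => hxC i (Finset.mem_erase.2 ⟨hij, hi⟩)⟩

end ConvexCover

/-! ### Minty's lemma and existence under compactness -/

section Minty

variable {E : Type*} [NormedAddCommGroup E] [InnerProductSpace ℝ E] {K : Set E} {G : E → E}

/-- The half-space of the points `x` at which `y` does not violate the Minty inequality. -/
def mintyHalfSpace (G : E → E) (y : E) : Set E :=
  {x | 0 ≤ ⟪y - x, G y⟫}

theorem isClosed_mintyHalfSpace (G : E → E) (y : E) : IsClosed (mintyHalfSpace G y) :=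
  isClosed_le continuous_const (by fun_prop)

theorem convex_mintyHalfSpace (G : E → E) (y : E) : Convex ℝ (mintyHalfSpace G y) := by
  have h : mintyHalfSpace G y = {x | innerₗ E (G y) x ≤ ⟪G y, y⟫} := by
    ext x
    simp only [mintyHalfSpace, Set.mem_ofPred_eq, inner_sub_left, sub_nonneg, innerₗ_apply_apply,
      real_inner_comm]
  rw [h]
  exact convex_halfSpace_le (innerₗ E (G y)).isLinear _

theorem mem_SOL_iff {x : E} : x ∈ SOL K G ↔ x ∈ K ∧ ∀ y ∈ K, 0 ≤ ⟪y - x, G x⟫ := by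
  simp only [SOL, normalCone, Set.mem_ofPred_eq, inner_neg_left, neg_nonpos, real_inner_comm]

/-- Minty's lemma. -/
theorem SOL_eq_inter_mintyHalfSpace (hK : Convex ℝ K) (hG : Continuous G)
    (hpseudo : PseudomonotoneOn G K) : SOL K G = K ∩ ⋂ y ∈ K, mintyHalfSpace G y := by
  ext x
  rw [mem_SOL_iff, Set.mem_inter_iff, Set.mem_iInter₂]
  refine and_congr_right fun hx => ⟨fun h y hy => hpseudo x hx y hy (h y hy), fun h y hy => ?_⟩
  have hlim : Tendsto (fun t : ℝ => ⟪y - x, G (x + t • (y - x))⟫) (𝓝[>] 0) (𝓝 ⟪y - x, G x⟫) := by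
    have hc : Continuous fun t : ℝ => ⟪y - x, G (x + t • (y - x))⟫ := by fun_prop
    simpa using (hc.tendsto 0).mono_left nhdsWithin_le_nhds
  refine ge_of_tendsto hlim ?_
  -- Test the Minty inequality at `x + t • (y - x)` and divide by `t`.
  filter_upwards [Ioo_mem_nhdsGT (zero_lt_one' ℝ)] with t ht
  have hm := h _ (hK.add_smul_sub_mem hx hy ⟨ht.1.le, ht.2.le⟩)
  rw [mintyHalfSpace, Set.mem_ofPred_eq, add_sub_cancel_left, real_inner_smul_left] at hm
  exact nonneg_of_mul_nonneg_right hm ht.1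

theorem convex_SOL (hK : Convex ℝ K) (hG : Continuous G) (hpseudo : PseudomonotoneOn G K) :
    Convex ℝ (SOL K G) := by
  rw [SOL_eq_inter_mintyHalfSpace hK hG hpseudo]
  exact hK.inter (convex_iInter₂ fun y _ => convex_mintyHalfSpace G y)

/-- The KKM condition: otherwise pseudomonotonicity puts all of `t` in the open half-space `⟪G x, ·⟫
< ⟪G x, x⟫`, which would then contain `x` itself. -/
theorem exists_mem_mintyHalfSpace_of_mem_convexHull (hK : Convex ℝ K)
    (hpseudo : PseudomonotoneOn G K) {t : Set E} (ht : t ⊆ K) {x : E}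
    (hx : x ∈ convexHull ℝ t) : ∃ y ∈ t, x ∈ mintyHalfSpace G y := by
  by_contra! h
  have hxK : x ∈ K := convexHull_min ht hK hx
  have hsub : t ⊆ {z | innerₗ E (G x) z < ⟪G x, x⟫} := fun y hy => by
    have hlt : ⟪y - x, G x⟫ < 0 := not_le.1 fun hle => h y hy (hpseudo x hxK y (ht hy) hle)
    rw [real_inner_comm, inner_sub_right] at hlt
    exact sub_neg.1 hlt
  have hlt : ⟪G x, x⟫ < ⟪G x, x⟫ :=
    convexHull_min hsub (convex_halfSpace_lt (innerₗ E (G x)).isLinear _) hx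
  exact lt_irrefl _ hlt

theorem nonempty_SOL_of_isCompact (hK : Convex ℝ K) (hG : Continuous G)
    (hpseudo : PseudomonotoneOn G K) {a : E} (ha : a ∈ K)
    (hcpt : IsCompact (K ∩ mintyHalfSpace G a)) : (SOL K G).Nonempty := by
  classical
  have hinter : ((K ∩ mintyHalfSpace G a) ∩ ⋂ y : K, mintyHalfSpace G (y : E)).Nonempty := by
    refine hcpt.inter_iInter_nonempty _ (fun y => isClosed_mintyHalfSpace G y) fun u => ?_
    -- Adjoining `a` to the finite family forces the common point into the compact set.
    have hsub : ((insert a (u.image Subtype.val) : Finset E) : Set E) ⊆ K := by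
      intro y hy
      rcases Finset.mem_insert.1 hy with rfl | hy
      · exact ha
      · obtain ⟨z, -, rfl⟩ := Finset.mem_image.1 hy
        exact z.2
    obtain ⟨x, hx, hxy⟩ := exists_mem_convexHull_forall_of_KKM (isClosed_mintyHalfSpace G)
      (convex_mintyHalfSpace G) (Finset.insert_nonempty a (u.image Subtype.val))
      fun t ht x hx => exists_mem_mintyHalfSpace_of_mem_convexHull hK hpseudo
        ((Finset.coe_subset.2 ht).trans hsub) hx
    exact ⟨x, ⟨convexHull_min hsub hK hx, hxy a (Finset.mem_insert_self _ _)⟩,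
      Set.mem_iInter₂.2 fun y hy =>
        hxy y (Finset.mem_insert_of_mem (Finset.mem_image_of_mem _ hy))⟩
  obtain ⟨x, ⟨hxK, -⟩, hx⟩ := hinter
  rw [SOL_eq_inter_mintyHalfSpace hK hG hpseudo]
  exact ⟨x, hxK, Set.mem_iInter₂.2 fun y hy => Set.mem_iInter.1 hx ⟨y, hy⟩⟩

end Minty

/-! ### Recession directions and compactness -/

section Recession

variable {E : Type*} [NormedAddCommGroup E] [InnerProductSpace ℝ E] {K : Set E}

/-- A limit of normalized directions of an unbounded sequence in a closed convex set is a recession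
direction. -/
theorem mem_recessionCone_of_tendsto (hK : Convex ℝ K) (hKc : IsClosed K) {x : ℕ → E}
    (hx : ∀ k, x k ∈ K) (hnorm : Tendsto (fun k => ‖x k‖) atTop atTop) {d : E}
    (hd : Tendsto (fun k => ‖x k‖⁻¹ • x k) atTop (𝓝 d)) : d ∈ recessionCone K := by
  intro y hy τ hτ
  have h0 : Tendsto (fun k => τ * ‖x k‖⁻¹) atTop (𝓝 0) := by
    simpa using (tendsto_inv_atTop_zero.comp hnorm).const_mul τ
  have hlim : Tendsto (fun k => (1 - τ * ‖x k‖⁻¹) • y + τ • (‖x k‖⁻¹ • x k)) atTop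
      (𝓝 (y + τ • d)) := by
    simpa using ((h0.const_sub 1).smul_const y).add (hd.const_smul τ)
  refine hKc.mem_of_tendsto hlim ?_
  -- Once `τ ≤ ‖x k‖`, the approximants are convex combinations of `y` and `x k`.
  filter_upwards [h0.eventually_le_const zero_lt_one] with k hk
  rw [smul_smul]
  exact hK hy (hx k) (sub_nonneg.2 hk) (mul_nonneg hτ (inv_nonneg.2 (norm_nonneg _))) (by ring)

/-- For small `t > 0` the vector `v - t • d` is still in the dual cone, so `⟪d, v⟫ ≥ t * ⟪d, d⟫ >
0`. -/
theorem inner_pos_of_mem_interior_innerDual [CompleteSpace E] {S : Set E} {v d : E}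
    (hv : v ∈ interior (ProperCone.innerDual S : Set E)) (hd : d ∈ S) (hd0 : d ≠ 0) :
    0 < ⟪d, v⟫ := by
  have hlim : Tendsto (fun t : ℝ => v - t • d) (𝓝[>] 0) (𝓝 v) := by
    have hc : Continuous fun t : ℝ => v - t • d := by fun_prop
    simpa using (hc.tendsto 0).mono_left nhdsWithin_le_nhds
  obtain ⟨t, ht, ht0⟩ :=
    ((hlim.eventually (mem_interior_iff_mem_nhds.1 hv)).and self_mem_nhdsWithin).exists
  have h : 0 ≤ ⟪d, v - t • d⟫ := ProperCone.mem_innerDual.1 ht hd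
  rw [inner_sub_right, real_inner_smul_right, sub_nonneg] at h
  exact (mul_pos ht0 (real_inner_self_pos.2 hd0)).trans_le h

/-- If the slice were unbounded, normalized points would subconverge to a unit recession direction
`d`; dividing `⟪x, v⟫ ≤ c` by `‖x‖` gives `⟪d, v⟫ ≤ 0`, against strict positivity. -/
theorem isCompact_inter_inner_le [FiniteDimensional ℝ E] [CompleteSpace E] (hK : Convex ℝ K)
    (hKc : IsClosed K) {v : E}
    (hv : v ∈ interior (ProperCone.innerDual (recessionCone K) : Set E)) (c : ℝ) :
    IsCompact (K ∩ {x | ⟪x, v⟫ ≤ c}) := by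
  have : ProperSpace E := FiniteDimensional.proper ℝ E
  refine Metric.isCompact_of_isClosed_isBounded
    (hKc.inter (isClosed_le (by fun_prop) continuous_const)) ?_
  by_contra hunb
  have hex : ∀ k : ℕ, ∃ x ∈ K ∩ {x | ⟪x, v⟫ ≤ c}, (k : ℝ) < ‖x‖ := fun k => by
    by_contra! h
    exact hunb (isBounded_iff_forall_norm_le.2 ⟨k, h⟩)
  choose x hx hxk using hex
  have hpos : ∀ k, 0 < ‖x k‖ := fun k => (Nat.cast_nonneg k).trans_lt (hxk k)
  have hnorm : Tendsto (fun k => ‖x k‖) atTop atTop :=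
    tendsto_atTop_mono (fun k => (hxk k).le) tendsto_natCast_atTop_atTop
  obtain ⟨d, hd, φ, hφ, hlim⟩ := (isCompact_sphere (0 : E) 1).tendsto_subseq
    (x := fun k => ‖x k‖⁻¹ • x k) fun k => by
      simp [norm_smul, inv_mul_cancel₀ (hpos k).ne']
  have hnormφ := hnorm.comp hφ.tendsto_atTop
  have hrec : d ∈ recessionCone K :=
    mem_recessionCone_of_tendsto hK hKc (x := x ∘ φ) (fun k => (hx _).1) hnormφ hlim
  have hle : ⟪d, v⟫ ≤ 0 := by
    have hright : Tendsto (fun k => ‖x (φ k)‖⁻¹ * c) atTop (𝓝 0) := by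
      simpa using (tendsto_inv_atTop_zero.comp hnormφ).mul_const c
    refine le_of_tendsto_of_tendsto' (hlim.inner tendsto_const_nhds) hright fun k => ?_
    simp only [Function.comp_apply, real_inner_smul_left]
    exact mul_le_mul_of_nonneg_left (hx (φ k)).2 (inv_nonneg.2 (norm_nonneg _))
  have hd0 : d ≠ 0 := fun h => by simp [h] at hd
  exact hle.not_gt (inner_pos_of_mem_interior_innerDual hv hrec hd0)

theorem nonempty_and_isCompact_SOL [FiniteDimensional ℝ E] [CompleteSpace E] {G : E → E}
    (hK : Convex ℝ K) (hKc : IsClosed K) (hG : Continuous G) (hpseudo : PseudomonotoneOn G K)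
    {a : E} (ha : a ∈ K)
    (hGa : G a ∈ interior (ProperCone.innerDual (recessionCone K) : Set E)) :
    (SOL K G).Nonempty ∧ IsCompact (SOL K G) := by
  have hcpt : IsCompact (K ∩ mintyHalfSpace G a) := by
    simpa only [mintyHalfSpace, inner_sub_left, sub_nonneg] using
      isCompact_inter_inner_le hK hKc hGa ⟪a, G a⟫
  refine ⟨nonempty_SOL_of_isCompact hK hG hpseudo ha hcpt, ?_⟩
  rw [SOL_eq_inter_mintyHalfSpace hK hG hpseudo]
  refine hcpt.of_isClosed_subset
    (hKc.inter (isClosed_biInter fun y _ => isClosed_mintyHalfSpace G y)) ?_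
  exact Set.inter_subset_inter_right K (Set.biInter_subset_of_mem ha)

end Recession

/-! ### Convexity and closedness of the feasible set -/

section Feasible

variable {N : ℕ} {Ξ : Fin N → Type*} [∀ k, Fintype (Ξ k)] (P : ScenarioLaw Ξ) {n : Fin N → ℕ}
  {C : (∀ k, Ξ k) → Set (Decision n)}

/-- Evaluation of a mapping `x(·)` at a scenario, as a linear map. -/
def evalLinear (ξ : ∀ k, Ξ k) : LSpace P n →ₗ[ℝ] Decision n where
  toFun x := x ξ
  map_add' _ _ := rfl
  map_smul' _ _ := rfl

theorem feasibleSet_eq :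
    feasibleSet P C = (⋂ ξ, evalLinear P ξ ⁻¹' C ξ) ∩ (nonanticipative P n : Set (LSpace P n)) := by
  ext x
  rw [feasibleSet, Set.mem_inter_iff, Set.mem_inter_iff, Set.mem_iInter]
  rfl

theorem convex_feasibleSet (hC : ∀ ξ, Convex ℝ (C ξ)) : Convex ℝ (feasibleSet P C) := by
  rw [feasibleSet_eq]
  exact (convex_iInter fun ξ => (hC ξ).linear_preimage (evalLinear P ξ)).inter
    (nonanticipative P n).convex

theorem isClosed_feasibleSet (hC : ∀ ξ, IsClosed (C ξ)) : IsClosed (feasibleSet P C) := by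
  rw [feasibleSet_eq]
  exact (isClosed_iInter fun ξ =>
    (hC ξ).preimage (evalLinear P ξ).continuous_of_finiteDimensional).inter
    (nonanticipative P n).closed_of_finiteDimensional

end Feasible

end MultistageSVI

theorem mainTheorem2 {N : ℕ} {Ξ : Fin N → Type*} [∀ k, Fintype (Ξ k)]
    (P : ScenarioLaw Ξ) (n : Fin N → ℕ)
    (C : (∀ k, Ξ k) → Set (Decision n))
    (hC_nonempty : ∀ ξ, (C ξ).Nonempty)
    (hC_closed : ∀ ξ, IsClosed (C ξ))
    (hC_convex : ∀ ξ, Convex ℝ (C ξ))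
    (F : Decision n → (∀ k, Ξ k) → Decision n)
    (hF_cont : Continuous (inducedMap P F))
    (hF_pseudo : PseudomonotoneOn (inducedMap P F) (feasibleSet P C)) :
    Convex ℝ (SOL (feasibleSet P C) (inducedMap P F)) ∧
      ((∃ x ∈ feasibleSet P C,
          inducedMap P F x ∈ interior
            (ProperCone.innerDual (recessionCone (feasibleSet P C)) : Set (LSpace P n))) →
        (SOL (feasibleSet P C) (inducedMap P F)).Nonempty ∧
          Convex ℝ (SOL (feasibleSet P C) (inducedMap P F)) ∧
          IsCompact (SOL (feasibleSet P C) (inducedMap P F))) := by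
  have hK := convex_feasibleSet P hC_convex
  have hconv := convex_SOL hK hF_cont hF_pseudo
  refine ⟨hconv, fun ⟨x, hx, hxF⟩ => ?_⟩
  obtain ⟨hne, hcpt⟩ :=
    nonempty_and_isCompact_SOL hK (isClosed_feasibleSet P hC_closed) hF_cont hF_pseudo hx hxF
  exact ⟨hne, hconv, hcpt⟩
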